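/- Let $K$ be a commutative ring. A $K$-algebra $B$ is called left strongly Noetherian if $B$ is left Noetherian and $C\otimes_K B$ is left Noetherian for every commutative Noetherian $K$-algebra $C$. Let $A$ be a ring, $R\subseteq A$ a subring and $x_1,\dots,x_n\in A$. One says that $A=\sigma(R)\langle x_1,\dots,x_n\rangle$ is a skew PBW extension of $R$ if (i) $A$ is a free left $R$-module with basis the standard monomials $x_1^{\alpha_1}\cdots x_n^{\alpha_n}$, $(\alpha_1,\dots,\alpha_n)\in\mathbb N^n$; (ii) for every $1\le i\le n$ and $r\in R\setminus\{0\}$ there is $c_{i,r}\in R\setminus\{0\}$ with $x_ir-c_{i,r}x_i\in R$; (iii) for all $1\le i,j\le n$ there is $c_{i,j}\in R\setminus\{0\}$ with $x_jx_i-c_{i,j}x_ix_j\in R+Rx_1+\cdots+Rx_n$. For each $i$ there is then a unique map $\sigma_i:R\to R$ with $x_ir-\sigma_i(r)x_i\in R$ for all $r\in R$, and $\sigma_i$ is a ring endomorphism. The extension is called bijective if every $\sigma_i$ is bijective and $c_{i,j}$ is invertible in $R$ for all $1\le i<j\le n$. Theorem. Let $K$ be a commutative ring, let $A$ be a $K$-algebra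 and $R\subseteq A$ a $K$-subalgebra such that $A=\sigma(R)\langle x_1,\dots,x_n\rangle$ is a bijective skew PBW extension of $R$. If the $K$-algebra $R$ is left strongly Noetherian, then so is the $K$-algebra $A$. -/

import Mathlib

open scoped TensorProduct

universe w u v

/-- The standard monomial `x^α = x₁^α₁ ⋯ xₙ^αₙ`, with the factors in this order. -/
def stdMonomial {A : Type*} [Ring A] {n : ℕ} (x : Fin n → A) (α : Fin n → ℕ) : A :=
  (List.ofFn fun i => x i ^ α i).prod

/-- `A` is a skew PBW extension of the subring `R` in the variables `x₁, …, xₙ`,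
that is, `A = σ(R)⟨x₁, …, xₙ⟩`. -/
structure IsSkewPBWExtension {A : Type*} [Ring A] (R : Subring A) {n : ℕ} (x : Fin n → A) :
    Prop where
  /-- The standard monomials are linearly independent in the left `R`-module `A`. -/
  linearIndependent : LinearIndependent R (stdMonomial x)
  /-- The standard monomials generate the left `R`-module `A`. -/
  span_eq_top : Submodule.span R (Set.range (stdMonomial x)) = ⊤
  exists_coeff : ∀ (i : Fin n) (r : R), r ≠ 0 →
    ∃ c : R, c ≠ 0 ∧ x i * (r : A) - (c : A) * x i ∈ R
  /-- The span of `1, x₁, …, xₙ` is `R + R x₁ + ⋯ + R xₙ`. -/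
  exists_comm : ∀ i j : Fin n,
    ∃ c : R, c ≠ 0 ∧ x j * x i - (c : A) * (x i * x j) ∈
      Submodule.span R (insert 1 (Set.range x))

namespace IsSkewPBWExtension

variable {A : Type*} [Ring A] {R : Subring A} {n : ℕ} {x : Fin n → A}

theorem stdMonomial_zero (x : Fin n → A) : stdMonomial x 0 = 1 := by
  simp [stdMonomial]

theorem stdMonomial_single (x : Fin n → A) (i : Fin n) :
    stdMonomial x (Pi.single i 1) = x i := by
  induction n with
  | zero => exact i.elim0
  | succ n ih =>
    have key : ∀ α : Fin (n + 1) → ℕ, stdMonomial x α =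
        x 0 ^ α 0 * stdMonomial (fun k => x k.succ) (fun k => α k.succ) := by
      intro α
      simp [stdMonomial, List.ofFn_succ]
    rw [key]
    induction i using Fin.cases with
    | zero =>
      have h0 : (fun k : Fin n => (Pi.single (0 : Fin (n + 1)) 1 : Fin (n + 1) → ℕ) k.succ) = 0 := by
        funext k
        simp [Fin.succ_ne_zero]
      rw [h0, stdMonomial_zero]
      simp
    | succ j =>
      have h1 : (fun k : Fin n => (Pi.single j.succ 1 : Fin (n + 1) → ℕ) k.succ) =
          Pi.single j 1 := by
        funext k
        simp [Pi.single_apply]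
      have h0 : (Pi.single j.succ 1 : Fin (n + 1) → ℕ) 0 = 0 := by
        simp [(Fin.succ_ne_zero j).symm]
      rw [h1, h0, ih]
      simp

/-- The leading coefficient `c` in `xᵢ r - c xᵢ ∈ R` is unique. -/
theorem coeff_unique (h : IsSkewPBWExtension R x) (i : Fin n) {a : A} {c d : R}
    (hc : a - (c : A) * x i ∈ R) (hd : a - (d : A) * x i ∈ R) : c = d := by
  have hne : (Pi.single i 1 : Fin n → ℕ) ≠ 0 := by
    intro h0
    have := congrFun h0 i
    simp at this
  have hmem : ((c - d : R) : A) * x i ∈ R := by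
    have := R.sub_mem hd hc
    have e : a - (d : A) * x i - (a - (c : A) * x i) = ((c - d : R) : A) * x i := by
      push_cast
      noncomm_ring
    rwa [e] at this
  have hinj : Function.Injective ![(Pi.single i 1 : Fin n → ℕ), 0] := by
    intro a b hab
    fin_cases a <;> fin_cases b
    · rfl
    · exact absurd hab hne
    · exact absurd hab.symm hne
    · rfl
  have hli : LinearIndependent R ![x i, 1] := by
    have h2 := h.linearIndependent.comp _ hinj
    convert h2 using 1
    funext k
    fin_cases k
    · simp [stdMonomial_single]
    · simp [stdMonomial_zero]
  have h4 := hli.eq_zero_of_pair (s := c - d) (t := -⟨_, hmem⟩) (by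
    simp [Subring.smul_def])
  exact sub_eq_zero.mp h4.1

theorem exists_coeff_all (h : IsSkewPBWExtension R x) (i : Fin n) (r : R) :
    ∃ c : R, x i * (r : A) - (c : A) * x i ∈ R := by
  by_cases hr : r = 0
  · exact ⟨0, by simp [hr]⟩
  · obtain ⟨c, -, hc⟩ := h.exists_coeff i r hr
    exact ⟨c, hc⟩

/-- The endomorphism `σᵢ` of `R`: the unique map such that `xᵢ r - σᵢ(r) xᵢ ∈ R` for all `r`. -/
noncomputable def endo (h : IsSkewPBWExtension R x) (i : Fin n) : R →+* R where
  toFun r := (h.exists_coeff_all i r).choose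
  map_one' := h.coeff_unique i (h.exists_coeff_all i 1).choose_spec (by simp)
  map_zero' := h.coeff_unique i (h.exists_coeff_all i 0).choose_spec (by simp)
  map_add' r s := by
    refine h.coeff_unique i (h.exists_coeff_all i (r + s)).choose_spec ?_
    have e := R.add_mem (h.exists_coeff_all i r).choose_spec (h.exists_coeff_all i s).choose_spec
    convert e using 1
    push_cast
    noncomm_ring
  map_mul' r s := by
    refine h.coeff_unique i (h.exists_coeff_all i (r * s)).choose_spec ?_
    have hr := (h.exists_coeff_all i r).choose_spec
    have hs := (h.exists_coeff_all i s).choose_spec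
    generalize (h.exists_coeff_all i r).choose = c at hr ⊢
    generalize (h.exists_coeff_all i s).choose = d at hs ⊢
    have e := R.add_mem (R.mul_mem hr s.2) (R.mul_mem c.2 hs)
    convert e using 1
    push_cast
    noncomm_ring

theorem endo_spec (h : IsSkewPBWExtension R x) (i : Fin n) (r : R) :
    x i * (r : A) - (h.endo i r : A) * x i ∈ R :=
  (h.exists_coeff_all i r).choose_spec

/-- The extension is bijective: every `σᵢ` is bijective, and for `i < j` the coefficient
`c_{i,j}` in `xⱼ xᵢ - c_{i,j} xᵢ xⱼ ∈ R + R x₁ + ⋯ + R xₙ`, which is unique because `xᵢ xⱼ` is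
a standard monomial, is invertible. -/
def IsBijective (h : IsSkewPBWExtension R x) : Prop :=
  (∀ i, Function.Bijective (h.endo i)) ∧
  ∀ i j : Fin n, i < j → ∃ c : R, IsUnit c ∧ x j * x i - (c : A) * (x i * x j) ∈
    Submodule.span R (insert 1 (Set.range x))

end IsSkewPBWExtension

/-- A `K`-algebra `A` is left strongly Noetherian if it is left Noetherian and `C ⊗[K] A` is left
Noetherian for every commutative Noetherian `K`-algebra `C` (in an arbitrary universe `w`).
Mathlib's `IsNoetherianRing` is the left-sided condition. -/
def IsLeftStronglyNoetherian (K : Type u) [CommRing K] (A : Type v) [Ring A]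
    [Algebra K A] : Prop :=
  IsNoetherianRing A ∧
  ∀ (C : Type w) [CommRing C] [Algebra K C], IsNoetherianRing C → IsNoetherianRing (C ⊗[K] A)

/-! This is a Hilbert basis argument that never uses linear independence of the monomials. What it
needs (spanning, surjective `σᵢ`, straightening relations with unit coefficients) is packaged as
`HasPBWStraightening` and passes to `C ⊗[K] A` over `C ⊗[K] R`, so one theorem settles both halves
of the conclusion.

Up to lower degree, monomials multiply as in a polynomial ring, up to units
(`exists_mul_stdMonomial`), and coefficients cross `x^α` through a surjective endomorphism
(`exists_endo_stdMonomial`). To a left ideal `I` and an exponent `α` one attaches the left ideal of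
leading coefficients written to the right of `x^α`. On that side they are untouched by left
multiplication by variables, so these ideals grow with `α` without a twist. They also detect strict
inclusions of left ideals. A strictly increasing chain in `B` would, by Dickson's lemma, yield one
in the coefficient ring. -/

theorem stdMonomial_succ {A : Type*} [Ring A] {n : ℕ} (x : Fin (n + 1) → A)
    (α : Fin (n + 1) → ℕ) :
    stdMonomial x α = x 0 ^ α 0 * stdMonomial (fun k => x k.succ) (fun k => α k.succ) := by
  simp [stdMonomial, List.ofFn_succ]

theorem map_stdMonomial {A B : Type*} [Ring A] [Ring B] (f : A →+* B) {n : ℕ}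
    (x : Fin n → A) (α : Fin n → ℕ) :
    f (stdMonomial x α) = stdMonomial (fun i => f (x i)) α := by
  simp [stdMonomial, map_list_prod, List.map_ofFn, Function.comp_def]

/-- Multiplying a standard monomial on the left by a variable that precedes all its factors. -/
theorem mul_stdMonomial_of_forall_lt {A : Type*} [Ring A] {n : ℕ} (x : Fin n → A) (i : Fin n)
    (α : Fin n → ℕ) (h : ∀ k < i, α k = 0) :
    x i * stdMonomial x α = stdMonomial x (α + Pi.single i 1) := by
  induction n with
  | zero => exact i.elim0
  | succ n ih =>
    rw [stdMonomial_succ, stdMonomial_succ x (α + _)]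
    induction i using Fin.cases with
    | zero =>
      have h0 : (fun k : Fin n => (α + Pi.single 0 1 : Fin (n + 1) → ℕ) k.succ) =
          fun k => α k.succ := by
        funext k
        simp
      rw [h0, ← mul_assoc, Pi.add_apply, Pi.single_eq_same, pow_succ']
    | succ j =>
      have h1 : (fun k : Fin n => (α + Pi.single j.succ 1 : Fin (n + 1) → ℕ) k.succ) =
          (fun k => α k.succ) + Pi.single j 1 := by
        funext k
        simp [Pi.single_apply]
      have h0 : α 0 = 0 := h 0 (Fin.succ_pos j)
      have h2 : (α + Pi.single j.succ 1 : Fin (n + 1) → ℕ) 0 = 0 := by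
        simp [h0]
      rw [h1, h2, h0, pow_zero, one_mul, one_mul,
        ← ih (fun k => x k.succ) j _ fun k hk => h _ (Fin.succ_lt_succ_iff.mpr hk)]

/-- A nonzero exponent is the sum of its first unit vector and of an exponent that does not
involve earlier variables. -/
theorem exists_eq_add_single {n : ℕ} (α : Fin n → ℕ) (hα : α ≠ 0) :
    ∃ (k : Fin n) (α' : Fin n → ℕ), α = α' + Pi.single k 1 ∧ ∀ l < k, α' l = 0 := by
  have hex : ∃ k, α k ≠ 0 := Function.ne_iff.mp hα
  obtain ⟨k, hk, hmin⟩ := WellFounded.has_min (wellFounded_lt (α := Fin n)) {k | α k ≠ 0} hex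
  have hle : (Pi.single k 1 : Fin n → ℕ) ≤ α := by
    intro l
    by_cases hl : l = k
    · subst hl
      simpa using Nat.one_le_iff_ne_zero.mpr hk
    · simp [hl]
  refine ⟨k, α - Pi.single k 1, (tsub_add_cancel_of_le hle).symm, fun l hl => ?_⟩
  have : α l = 0 := by
    by_contra h
    exact hmin l h hl
  simp [this]

/-! ### Degree-lexicographic order -/

theorem sum_add_single {n : ℕ} (α : Fin n → ℕ) (i : Fin n) :
    ∑ k, (α + Pi.single i 1 : Fin n → ℕ) k = ∑ k, α k + 1 := by
  simp [Finset.sum_add_distrib]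

/-- The degree-lexicographic order on exponents. -/
def degLexKey {n : ℕ} (α : Fin n → ℕ) : ℕ ×ₗ Lex (Fin n → ℕ) :=
  toLex (∑ k, α k, toLex α)

theorem degLexKey_injective {n : ℕ} :
    Function.Injective (degLexKey : (Fin n → ℕ) → ℕ ×ₗ Lex (Fin n → ℕ)) := by
  intro α β h
  have := congrArg (fun z => (ofLex z).2) h
  exact toLex.injective this

theorem degLexKey_lt_of_sum_lt {n : ℕ} {α β : Fin n → ℕ} (h : ∑ k, β k < ∑ k, α k) :
    degLexKey β < degLexKey α :=
  Prod.Lex.toLex_lt_toLex.mpr (Or.inl h)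

theorem sum_le_of_degLexKey_lt {n : ℕ} {α β : Fin n → ℕ} (h : degLexKey β < degLexKey α) :
    ∑ k, β k ≤ ∑ k, α k := by
  rcases Prod.Lex.toLex_lt_toLex.mp h with h | h
  · exact h.le
  · exact h.1.le

theorem degLexKey_add_lt {n : ℕ} {α β : Fin n → ℕ} (h : degLexKey β < degLexKey α)
    (γ : Fin n → ℕ) : degLexKey (β + γ) < degLexKey (α + γ) := by
  refine Prod.Lex.toLex_lt_toLex.mpr ?_
  simp only [Pi.add_apply, Finset.sum_add_distrib]
  rcases Prod.Lex.toLex_lt_toLex.mp h with h | ⟨h, k, hk, hlt⟩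
  · exact Or.inl (Nat.add_lt_add_right h _)
  · refine Or.inr ⟨congrArg (· + _) h, k, fun l hl => ?_, ?_⟩
    · exact congrArg (· + γ l) (hk l hl)
    · exact Nat.add_lt_add_right hlt (γ k)

/-! ### Spans of monomials with restricted exponents -/

/-- The left span of the standard monomials whose exponents satisfy `p`. -/
def monomialSpan {B : Type*} [Ring B] (T : Subring B) {n : ℕ} (x : Fin n → B)
    (p : (Fin n → ℕ) → Prop) : Submodule T B :=
  Submodule.span T {b | ∃ α, p α ∧ stdMonomial x α = b}

section monomialSpan

variable {B : Type*} [Ring B] {T : Subring B} {n : ℕ} {x : Fin n → B}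
  {p q : (Fin n → ℕ) → Prop}

theorem stdMonomial_mem {α : Fin n → ℕ} (h : p α) : stdMonomial x α ∈ monomialSpan T x p :=
  Submodule.subset_span ⟨α, h, rfl⟩

theorem monomialSpan_le {M : Submodule T B} (h : ∀ α, p α → stdMonomial x α ∈ M) :
    monomialSpan T x p ≤ M :=
  Submodule.span_le.mpr (by rintro _ ⟨α, hα, rfl⟩; exact h α hα)

theorem monomialSpan_mono (h : ∀ α, p α → q α) : monomialSpan T x p ≤ monomialSpan T x q :=
  monomialSpan_le fun α hα => stdMonomial_mem (h α hα)

theorem mul_mem_of_mem_subring {M : Submodule T B} {a b : B} (ha : a ∈ T) (h : b ∈ M) :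
    a * b ∈ M :=
  M.smul_mem (⟨a, ha⟩ : T) h

/-- Left multiplication by an element that normalizes `T` up to `T` is controlled on a span by its
values on the generating monomials. -/
theorem mul_mem_of_mem_monomialSpan {M : Submodule T B} {y : B}
    (hy : ∀ r ∈ T, ∃ c ∈ T, y * r - c * y ∈ T)
    (h1 : ∀ α, p α → stdMonomial x α ∈ M) (h2 : ∀ α, p α → y * stdMonomial x α ∈ M)
    {b : B} (hb : b ∈ monomialSpan T x p) : y * b ∈ M := by
  -- Since `y r b = c y b + (y r - c y) b`, the scalar step also needs `b` itself in `M`.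
  suffices b ∈ M ∧ y * b ∈ M from this.2
  induction hb using Submodule.span_induction with
  | mem b hb =>
    obtain ⟨α, hα, rfl⟩ := hb
    exact ⟨h1 α hα, h2 α hα⟩
  | zero => simp
  | add a b _ _ ha hb =>
    rw [mul_add]
    exact ⟨M.add_mem ha.1 hb.1, M.add_mem ha.2 hb.2⟩
  | smul r b _ hb =>
    refine ⟨M.smul_mem r hb.1, ?_⟩
    obtain ⟨c, hcT, hc⟩ := hy r r.2
    have e : y * (r • b) = c * (y * b) + (y * (r : B) - c * y) * b := by
      rw [Subring.smul_def, smul_eq_mul]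
      noncomm_ring
    rw [e]
    exact M.add_mem (mul_mem_of_mem_subring hcT hb.2) (mul_mem_of_mem_subring hc hb.1)

theorem mul_right_mem_of_mem_monomialSpan {M : Submodule T B} {s : B}
    (h : ∀ α, p α → stdMonomial x α * s ∈ M) {b : B} (hb : b ∈ monomialSpan T x p) :
    b * s ∈ M := by
  induction hb using Submodule.span_induction with
  | mem b hb =>
    obtain ⟨α, hα, rfl⟩ := hb
    exact h α hα
  | zero => simp
  | add a b _ _ ha hb =>
    rw [add_mul]
    exact M.add_mem ha hb
  | smul r b _ hb =>
    rw [smul_mul_assoc]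
    exact M.smul_mem r hb

/-- A nonzero element of a monomial span has a dominating exponent. -/
theorem eq_zero_or_exists_mem_le {b : B} (hb : b ∈ monomialSpan T x p) :
    b = 0 ∨ ∃ β, p β ∧ b ∈ monomialSpan T x (degLexKey · ≤ degLexKey β) := by
  induction hb using Submodule.span_induction with
  | mem b hb =>
    obtain ⟨α, hα, rfl⟩ := hb
    exact Or.inr ⟨α, hα, stdMonomial_mem le_rfl⟩
  | zero => exact Or.inl rfl
  | add a b _ _ ha hb =>
    rcases ha with rfl | ⟨α, hα, ha⟩
    · rwa [zero_add]
    rcases hb with rfl | ⟨β, hβ, hb⟩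
    · rw [add_zero]
      exact Or.inr ⟨α, hα, ha⟩
    rcases le_total (degLexKey α) (degLexKey β) with h | h
    · exact Or.inr ⟨β, hβ, add_mem (monomialSpan_mono (fun γ hγ => le_trans hγ h) ha) hb⟩
    · exact Or.inr ⟨α, hα, add_mem ha (monomialSpan_mono (fun γ hγ => le_trans hγ h) hb)⟩
  | smul r b _ hb =>
    rcases hb with rfl | ⟨β, hβ, hb⟩
    · exact Or.inl (smul_zero r)
    · exact Or.inr ⟨β, hβ, Submodule.smul_mem _ r hb⟩

/-- Splitting off the leading term. -/
theorem exists_sub_mem_lt {α : Fin n → ℕ} {b : B}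
    (hb : b ∈ monomialSpan T x (degLexKey · ≤ degLexKey α)) :
    ∃ t ∈ T, b - t * stdMonomial x α ∈ monomialSpan T x (degLexKey · < degLexKey α) := by
  have hle : monomialSpan T x (degLexKey · ≤ degLexKey α) ≤
      Submodule.span T (insert (stdMonomial x α)
        {b | ∃ γ, degLexKey γ < degLexKey α ∧ stdMonomial x γ = b}) := by
    refine monomialSpan_le fun γ hγ => Submodule.subset_span ?_
    rcases hγ.eq_or_lt with h | h
    · exact Or.inl (congrArg _ (degLexKey_injective h))
    · exact Or.inr ⟨γ, h, rfl⟩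
  obtain ⟨t, z, hz, rfl⟩ := Submodule.mem_span_insert.mp (hle hb)
  refine ⟨t, t.2, ?_⟩
  rw [Subring.smul_def, smul_eq_mul, add_sub_cancel_left]
  exact hz

end monomialSpan

/-! ### Straightening relations -/

/-- `B` is generated by the image of `φ` and by the `xᵢ`, subject to the straightening relations of
a bijective skew PBW extension with endomorphisms `σᵢ`. The standard monomials are required to
span, but not to be linearly independent. -/
structure HasPBWStraightening {S B : Type*} [Ring S] [Ring B] (φ : S →+* B) {n : ℕ}
    (x : Fin n → B) (σ : Fin n → S →+* S) : Prop where
  span_eq_top : Submodule.span φ.range (Set.range (stdMonomial x)) = ⊤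
  surjective : ∀ i, Function.Surjective (σ i)
  mul_map : ∀ (i : Fin n) (s : S), x i * φ s - φ (σ i s) * x i ∈ φ.range
  exists_comm : ∀ i j : Fin n, i < j → ∃ c : S, IsUnit c ∧
    x j * x i - φ c * (x i * x j) ∈ Submodule.span φ.range (insert 1 (Set.range x))

namespace HasPBWStraightening

variable {S B : Type*} [Ring S] [Ring B] {φ : S →+* B} {n : ℕ} {x : Fin n → B}
  {σ : Fin n → S →+* S}

theorem exists_mul_sub (h : HasPBWStraightening φ x σ) (i : Fin n) :
    ∀ r ∈ φ.range, ∃ c ∈ φ.range, x i * r - c * x i ∈ φ.range := by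
  rintro _ ⟨s, rfl⟩
  exact ⟨φ (σ i s), ⟨_, rfl⟩, h.mul_map i s⟩

/-- Up to lower degree, left multiplication by a variable acts on standard monomials as in a
commutative polynomial ring, up to a unit. -/
theorem exists_mul_stdMonomial_of_sum_eq (h : HasPBWStraightening φ x σ) (m : ℕ) :
    ∀ (i : Fin n) (α : Fin n → ℕ), ∑ k, α k = m → ∃ c : S, IsUnit c ∧
      x i * stdMonomial x α - φ c * stdMonomial x (α + Pi.single i 1) ∈
        monomialSpan φ.range x (∑ k, · k < m + 1) := by
  induction m using Nat.strong_induction_on with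
  | _ m ih =>
  intro i α hα
  by_cases hi : ∀ k < i, α k = 0
  · refine ⟨1, isUnit_one, ?_⟩
    rw [mul_stdMonomial_of_forall_lt x i α hi]
    simp
  have hα0 : α ≠ 0 := by
    rintro rfl
    exact hi fun _ _ => rfl
  -- The first variable `x_k` of `x^α` precedes `x_i`: swap the two, then move `x_i` into the
  -- shorter monomial `x^α'` by induction.
  obtain ⟨k, α', rfl, hk⟩ := exists_eq_add_single α hα0
  have hki : k < i := by
    by_contra hlt
    refine hi fun l hl => ?_
    have hlk : l < k := lt_of_lt_of_le hl (not_lt.mp hlt)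
    simp [hk l hlk, hlk.ne]
  rw [sum_add_single] at hα
  subst hα
  set m := ∑ l, α' l with hm
  have hstep : ∀ j β, ∑ l, β l < m + 1 →
      x j * stdMonomial x β ∈ monomialSpan φ.range x (∑ k, · k < m + 1 + 1) := by
    intro j β hβ
    obtain ⟨c, -, hc⟩ := ih _ hβ j β rfl
    rw [← sub_add_cancel (x j * stdMonomial x β) (φ c * stdMonomial x (β + Pi.single j 1))]
    refine add_mem (monomialSpan_mono (fun γ hγ => by omega) hc)
      (mul_mem_of_mem_subring ⟨c, rfl⟩ (stdMonomial_mem ?_))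
    rw [sum_add_single]
    omega
  obtain ⟨c, hcu, hc⟩ := h.exists_comm k i hki
  obtain ⟨d, hdu, hd⟩ := ih m (Nat.lt_succ_self m) i α' rfl
  -- The swap contributes `c`; the unit `d` from the induction becomes `σ k d` on crossing `x_k`.
  refine ⟨c * σ k d, hcu.mul (hdu.map (σ k)), ?_⟩
  have hα' : stdMonomial x α' ∈ monomialSpan φ.range x (∑ k, · k < m + 1 + 1) :=
    stdMonomial_mem (by omega)
  have h1 : (x i * x k - φ c * (x k * x i)) * stdMonomial x α' ∈
      monomialSpan φ.range x (∑ k, · k < m + 1 + 1) := by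
    generalize x i * x k - φ c * (x k * x i) = b at hc
    induction hc using Submodule.span_induction with
    | mem b hb =>
      rcases hb with rfl | ⟨j, rfl⟩
      · rwa [one_mul]
      · exact hstep j α' (Nat.lt_succ_self m)
    | zero => simp
    | add a b _ _ ha hb =>
      rw [add_mul]
      exact add_mem ha hb
    | smul r b _ hb =>
      rw [smul_mul_assoc]
      exact Submodule.smul_mem _ r hb
  have h2 : x k * (x i * stdMonomial x α' - φ d * stdMonomial x (α' + Pi.single i 1)) ∈
      monomialSpan φ.range x (∑ k, · k < m + 1 + 1) :=
    mul_mem_of_mem_monomialSpan (h.exists_mul_sub k)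
      (fun β hβ => stdMonomial_mem (by omega)) (fun β hβ => hstep k β hβ) hd
  have h3 : (x k * φ d - φ (σ k d) * x k) * stdMonomial x (α' + Pi.single i 1) ∈
      monomialSpan φ.range x (∑ k, · k < m + 1 + 1) :=
    mul_mem_of_mem_subring (h.mul_map k d) (stdMonomial_mem (by rw [sum_add_single]; omega))
  have e1 : x k * stdMonomial x α' = stdMonomial x (α' + Pi.single k 1) :=
    mul_stdMonomial_of_forall_lt x k α' hk
  have e2 : x k * stdMonomial x (α' + Pi.single i 1) =
      stdMonomial x (α' + Pi.single k 1 + Pi.single i 1) := by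
    rw [add_right_comm]
    refine mul_stdMonomial_of_forall_lt x k _ fun l hl => ?_
    simp [hk l hl, (hl.trans hki).ne]
  have e : x i * stdMonomial x (α' + Pi.single k 1) -
      φ (c * σ k d) * stdMonomial x (α' + Pi.single k 1 + Pi.single i 1) =
      (x i * x k - φ c * (x k * x i)) * stdMonomial x α' +
      φ c * (x k * (x i * stdMonomial x α' - φ d * stdMonomial x (α' + Pi.single i 1)) +
        (x k * φ d - φ (σ k d) * x k) * stdMonomial x (α' + Pi.single i 1)) := by
    rw [← e1, ← e2, map_mul]
    noncomm_ring
  rw [e]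
  exact add_mem h1 (mul_mem_of_mem_subring ⟨c, rfl⟩ (add_mem h2 h3))

theorem exists_mul_stdMonomial (h : HasPBWStraightening φ x σ) (i : Fin n) (α : Fin n → ℕ) :
    ∃ c : S, IsUnit c ∧
      x i * stdMonomial x α - φ c * stdMonomial x (α + Pi.single i 1) ∈
        monomialSpan φ.range x (∑ k, · k < ∑ k, α k + 1) :=
  h.exists_mul_stdMonomial_of_sum_eq _ i α rfl

theorem mul_mem_monomialSpan_sum_lt (h : HasPBWStraightening φ x σ) (i : Fin n) {m : ℕ} {b : B}
    (hb : b ∈ monomialSpan φ.range x (∑ k, · k < m)) :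
    x i * b ∈ monomialSpan φ.range x (∑ k, · k < m + 1) := by
  refine mul_mem_of_mem_monomialSpan (h.exists_mul_sub i)
    (fun β hβ => stdMonomial_mem (by omega)) (fun β hβ => ?_) hb
  obtain ⟨c, -, hc⟩ := h.exists_mul_stdMonomial i β
  rw [← sub_add_cancel (x i * stdMonomial x β) (φ c * stdMonomial x (β + Pi.single i 1))]
  refine add_mem (monomialSpan_mono (fun γ hγ => by omega) hc)
    (mul_mem_of_mem_subring ⟨c, rfl⟩ (stdMonomial_mem ?_))
  rw [sum_add_single]
  omega

/-- Adding a unit vector preserves the order on exponents, and the straightening error drops in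
total degree, hence in the order. -/
theorem mul_mem_monomialSpan_degLexKey_lt (h : HasPBWStraightening φ x σ) (i : Fin n)
    {α : Fin n → ℕ} {b : B} (hb : b ∈ monomialSpan φ.range x (degLexKey · < degLexKey α)) :
    x i * b ∈ monomialSpan φ.range x (degLexKey · < degLexKey (α + Pi.single i 1)) := by
  have hlt : degLexKey α < degLexKey (α + Pi.single i 1) :=
    degLexKey_lt_of_sum_lt (by rw [sum_add_single]; omega)
  refine mul_mem_of_mem_monomialSpan (h.exists_mul_sub i)
    (fun β hβ => stdMonomial_mem (lt_trans hβ hlt)) (fun β hβ => ?_) hb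
  obtain ⟨c, -, hc⟩ := h.exists_mul_stdMonomial i β
  rw [← sub_add_cancel (x i * stdMonomial x β) (φ c * stdMonomial x (β + Pi.single i 1))]
  refine add_mem (monomialSpan_mono (fun γ hγ => degLexKey_lt_of_sum_lt ?_) hc)
    (mul_mem_of_mem_subring ⟨c, rfl⟩ (stdMonomial_mem (degLexKey_add_lt hβ _)))
  have := sum_le_of_degLexKey_lt hβ
  rw [sum_add_single]
  omega

/-- Every exponent `α` carries a surjective endomorphism of `S` that describes how coefficients
move past `x^α`, up to lower degree. -/
theorem exists_endo_stdMonomial (h : HasPBWStraightening φ x σ) (α : Fin n → ℕ) :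
    ∃ τ : S →+* S, Function.Surjective τ ∧ ∀ s,
      stdMonomial x α * φ s - φ (τ s) * stdMonomial x α ∈
        monomialSpan φ.range x (∑ k, · k < ∑ k, α k) := by
  induction hm : ∑ k, α k generalizing α with
  | zero =>
    have h0 : α = 0 := by
      funext k
      simpa using (Finset.sum_eq_zero_iff.mp hm) k (Finset.mem_univ k)
    subst h0
    refine ⟨RingHom.id S, Function.surjective_id, fun s => ?_⟩
    simp [IsSkewPBWExtension.stdMonomial_zero]
  | succ m ih =>
    have hα0 : α ≠ 0 := by
      rintro rfl
      simp at hm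
    obtain ⟨k, α', rfl, hk⟩ := exists_eq_add_single α hα0
    rw [sum_add_single] at hm
    obtain ⟨τ, hτ, hτs⟩ := ih α' (by omega)
    -- The coefficient crosses `x^α'` first, then `x_k`.
    refine ⟨(σ k).comp τ, (h.surjective k).comp hτ, fun s => ?_⟩
    rw [← mul_stdMonomial_of_forall_lt x k α' hk]
    have e : x k * stdMonomial x α' * φ s - φ ((σ k).comp τ s) * (x k * stdMonomial x α') =
        x k * (stdMonomial x α' * φ s - φ (τ s) * stdMonomial x α') +
        (x k * φ (τ s) - φ (σ k (τ s)) * x k) * stdMonomial x α' := by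
      rw [RingHom.comp_apply]
      noncomm_ring
    rw [e]
    exact add_mem (h.mul_mem_monomialSpan_sum_lt k (hτs s))
      (mul_mem_of_mem_subring (h.mul_map k _) (stdMonomial_mem (by omega)))

theorem sum_lt_le_degLexKey_lt (α : Fin n → ℕ) :
    monomialSpan φ.range x (∑ k, · k < ∑ k, α k) ≤
      monomialSpan φ.range x (degLexKey · < degLexKey α) :=
  monomialSpan_mono fun _ h => degLexKey_lt_of_sum_lt h

theorem mul_map_mem_monomialSpan_degLexKey_lt (h : HasPBWStraightening φ x σ)
    {α : Fin n → ℕ} {b : B} (s : S)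
    (hb : b ∈ monomialSpan φ.range x (degLexKey · < degLexKey α)) :
    b * φ s ∈ monomialSpan φ.range x (degLexKey · < degLexKey α) := by
  refine mul_right_mem_of_mem_monomialSpan (fun β hβ => ?_) hb
  obtain ⟨τ, -, hτ⟩ := h.exists_endo_stdMonomial β
  rw [← sub_add_cancel (stdMonomial x β * φ s) (φ (τ s) * stdMonomial x β)]
  exact add_mem
    (monomialSpan_mono (fun γ hγ => (degLexKey_lt_of_sum_lt hγ).trans hβ) (hτ s))
    (mul_mem_of_mem_subring ⟨_, rfl⟩ (stdMonomial_mem hβ))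

/-! ### Leading ideals and the Noetherian property -/

/-- The left ideal of the coefficients `s`, written on the right of the monomial, of the elements
`x^α s + (smaller terms)` of a left ideal `I`. -/
def leadingIdeal (h : HasPBWStraightening φ x σ) (α : Fin n → ℕ) (I : Ideal B) : Ideal S where
  carrier := {s | ∃ f ∈ I, f - stdMonomial x α * φ s ∈
    monomialSpan φ.range x (degLexKey · < degLexKey α)}
  zero_mem' := ⟨0, I.zero_mem, by simp⟩
  add_mem' := by
    rintro s t ⟨f, hf, hfs⟩ ⟨g, hg, hgt⟩
    refine ⟨f + g, I.add_mem hf hg, ?_⟩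
    have e := add_mem hfs hgt
    rwa [← add_sub_add_comm, ← mul_add, ← map_add] at e
  smul_mem' := by
    rintro r s ⟨f, hf, hfs⟩
    obtain ⟨τ, -, hτ⟩ := h.exists_endo_stdMonomial α
    -- Left multiplication by `τ r` has the leading effect of inserting `r` just to the right of
    -- `x^α`.
    refine ⟨φ (τ r) * f, I.mul_mem_left _ hf, ?_⟩
    have e : φ (τ r) * f - stdMonomial x α * φ (r • s) =
        φ (τ r) * (f - stdMonomial x α * φ s) -
          (stdMonomial x α * φ r - φ (τ r) * stdMonomial x α) * φ s := by
      rw [smul_eq_mul, map_mul]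
      noncomm_ring
    rw [e]
    exact sub_mem (mul_mem_of_mem_subring ⟨_, rfl⟩ hfs)
      (h.mul_map_mem_monomialSpan_degLexKey_lt s (sum_lt_le_degLexKey_lt α (hτ r)))

theorem leadingIdeal_mono (h : HasPBWStraightening φ x σ) (α : Fin n → ℕ) :
    Monotone (h.leadingIdeal α) := by
  rintro I J hIJ s ⟨f, hf, hfs⟩
  exact ⟨f, hIJ hf, hfs⟩

/-- Multiplying by `x_i` raises the exponent and introduces only a unit on the left, which its
inverse cancels; the right-hand coefficient is unchanged. -/
theorem leadingIdeal_le_add_single (h : HasPBWStraightening φ x σ) (α : Fin n → ℕ) (i : Fin n)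
    (I : Ideal B) : h.leadingIdeal α I ≤ h.leadingIdeal (α + Pi.single i 1) I := by
  rintro s ⟨f, hf, hfs⟩
  obtain ⟨c, ⟨u, rfl⟩, hc⟩ := h.exists_mul_stdMonomial i α
  refine ⟨φ ↑u⁻¹ * (x i * f), I.mul_mem_left _ (I.mul_mem_left _ hf), ?_⟩
  have hu : φ ↑u⁻¹ * φ ↑u = 1 := by
    rw [← map_mul, Units.inv_mul, map_one]
  rw [← sum_add_single α i] at hc
  have e : φ ↑u⁻¹ * (x i * f) - stdMonomial x (α + Pi.single i 1) * φ s =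
      φ ↑u⁻¹ * (x i * (f - stdMonomial x α * φ s) +
        (x i * stdMonomial x α - φ u * stdMonomial x (α + Pi.single i 1)) * φ s) := by
    calc _ = φ ↑u⁻¹ * (x i * f) -
          φ ↑u⁻¹ * φ ↑u * (stdMonomial x (α + Pi.single i 1) * φ s) := by rw [hu, one_mul]
      _ = _ := by noncomm_ring
  rw [e]
  exact mul_mem_of_mem_subring ⟨_, rfl⟩ (add_mem (h.mul_mem_monomialSpan_degLexKey_lt i hfs)
    (h.mul_map_mem_monomialSpan_degLexKey_lt s (sum_lt_le_degLexKey_lt _ hc)))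

theorem leadingIdeal_mono_exponent (h : HasPBWStraightening φ x σ) (I : Ideal B) :
    Monotone fun α => h.leadingIdeal α I := by
  intro α β hαβ
  obtain ⟨γ, rfl⟩ := exists_add_of_le hαβ
  clear hαβ
  dsimp only
  induction hm : ∑ k, γ k generalizing γ with
  | zero =>
    have h0 : γ = 0 := by
      funext k
      simpa using (Finset.sum_eq_zero_iff.mp hm) k (Finset.mem_univ k)
    rw [h0, add_zero]
  | succ m ih =>
    have hγ : γ ≠ 0 := by
      rintro rfl
      simp at hm
    obtain ⟨k, γ', rfl, -⟩ := exists_eq_add_single γ hγ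
    rw [sum_add_single] at hm
    rw [← add_assoc]
    exact (ih γ' (by omega)).trans (h.leadingIdeal_le_add_single _ k I)

/-- Nested left ideals with the same leading ideals are equal. -/
theorem le_of_leadingIdeal_le (h : HasPBWStraightening φ x σ) {I J : Ideal B} (hIJ : I ≤ J)
    (hle : ∀ α, h.leadingIdeal α J ≤ h.leadingIdeal α I) : J ≤ I := by
  -- Well-founded induction on a dominating exponent: subtract an element of `I` with the same
  -- leading term.
  have key : ∀ (z : ℕ ×ₗ Lex (Fin n → ℕ)) (α : Fin n → ℕ), degLexKey α = z →
      ∀ f ∈ J, f ∈ monomialSpan φ.range x (degLexKey · ≤ degLexKey α) → f ∈ I := by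
    intro z
    induction z using WellFoundedLT.induction with
    | ind z ih =>
    rintro α rfl f hf hfα
    obtain ⟨_, ⟨t, rfl⟩, ht⟩ := exists_sub_mem_lt hfα
    obtain ⟨τ, hτ, hτs⟩ := h.exists_endo_stdMonomial α
    -- Surjectivity turns the left leading coefficient into a right one.
    obtain ⟨s, rfl⟩ := hτ t
    have hs : f - stdMonomial x α * φ s ∈
        monomialSpan φ.range x (degLexKey · < degLexKey α) := by
      have := sub_mem ht (sum_lt_le_degLexKey_lt α (hτs s))
      rwa [sub_sub, add_sub_cancel] at this
    obtain ⟨g, hg, hgs⟩ := hle α ⟨f, hf, hs⟩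
    have hfg : f - g ∈ monomialSpan φ.range x (degLexKey · < degLexKey α) := by
      have := sub_mem hs hgs
      rwa [sub_sub_sub_cancel_right] at this
    have hfgJ : f - g ∈ J := J.sub_mem hf (hIJ hg)
    have hfgI : f - g ∈ I := by
      rcases eq_zero_or_exists_mem_le hfg with h0 | ⟨β, hβ, hmem⟩
      · rw [h0]
        exact I.zero_mem
      · exact ih _ hβ β rfl _ hfgJ hmem
    simpa using I.add_mem hfgI hg
  intro f hf
  have htop : f ∈ monomialSpan φ.range x (fun _ => True) := by
    have : f ∈ Submodule.span φ.range (Set.range (stdMonomial x)) := by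
      rw [h.span_eq_top]
      trivial
    refine Submodule.span_mono ?_ this
    rintro _ ⟨α, rfl⟩
    exact ⟨α, trivial, rfl⟩
  rcases eq_zero_or_exists_mem_le htop with h0 | ⟨β, -, hmem⟩
  · rw [h0]
    exact I.zero_mem
  · exact key _ β rfl f hf hmem

/-- The skew Hilbert basis theorem. -/
theorem isNoetherianRing (h : HasPBWStraightening φ x σ) [IsNoetherianRing S] :
    IsNoetherianRing B := by
  rw [isNoetherianRing_iff, isNoetherian_iff']
  by_contra hwf
  obtain ⟨I, hI⟩ : ∃ I : ℕ → Ideal B, StrictMono I := by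
    obtain ⟨f⟩ := not_isEmpty_iff.mp fun he => hwf ⟨RelEmbedding.wellFounded_iff_isEmpty.mpr he⟩
    exact ⟨f, fun a b hab => f.map_rel_iff.mpr hab⟩
  have hne : ∀ k, ∃ α, h.leadingIdeal α (I k) < h.leadingIdeal α (I (k + 1)) := by
    intro k
    by_contra! hcon
    refine (hI (Nat.lt_succ_self k)).not_ge
      (h.le_of_leadingIdeal_le (hI (Nat.lt_succ_self k)).le fun α => ?_)
    have hle := h.leadingIdeal_mono α (hI (Nat.lt_succ_self k)).le
    exact (hle.eq_of_not_lt (hcon α)).ge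
  choose α hα using hne
  -- Dickson's lemma: along a subsequence the exponents where the leading ideals jump are monotone.
  -- Each jump stays strict when ideal and exponent then grow.
  obtain ⟨g, hg⟩ := (wellQuasiOrdered_le (α := Fin n → ℕ)).exists_monotone_subseq α
  have hlt : StrictMono fun k => h.leadingIdeal (α (g k)) (I (g k)) :=
    strictMono_nat_of_lt_succ fun k =>
      (hα (g k)).trans_le <|
        (h.leadingIdeal_mono _ (hI.monotone (g.strictMono (Nat.lt_succ_self k)))).trans
          (h.leadingIdeal_mono_exponent _ (hg _ _ (Nat.le_succ k)))
  exact not_strictMono_of_wellFoundedGT _ hlt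

end HasPBWStraightening

/-! ### Base change and conclusion -/

namespace IsSkewPBWExtension

variable {K : Type*} [CommRing K] {A : Type*} [Ring A] [Algebra K A] {R : Subalgebra K A} {n : ℕ}
  {x : Fin n → A}

theorem hasPBWStraightening (hA : IsSkewPBWExtension R.toSubring x) (hbij : hA.IsBijective) :
    HasPBWStraightening R.toSubring.subtype x hA.endo where
  span_eq_top := by
    rw [Subring.range_subtype]
    exact hA.span_eq_top
  surjective i := (hbij.1 i).2
  mul_map i s := by
    rw [Subring.range_subtype]
    exact hA.endo_spec i s
  exists_comm i j hij := by
    rw [Subring.range_subtype]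
    exact hbij.2 i j hij

/-- The endomorphisms `σᵢ` are `K`-linear because the image of `K` in `A` is central. -/
noncomputable def endoAlgHom (hA : IsSkewPBWExtension R.toSubring x) (i : Fin n) : R →ₐ[K] R :=
  { (hA.endo i : R →+* R) with
    commutes' := fun k => by
      refine hA.coeff_unique i (hA.endo_spec i (algebraMap K R k)) ?_
      have : x i * algebraMap K A k - algebraMap K A k * x i = 0 := by
        rw [Algebra.commutes, sub_self]
      exact (congrArg (· ∈ R.toSubring) this).mpr (zero_mem _) }

theorem endoAlgHom_apply (hA : IsSkewPBWExtension R.toSubring x) (i : Fin n) (r : R) :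
    hA.endoAlgHom i r = hA.endo i r :=
  rfl

/-- Bijective skew PBW extensions straighten after base change. -/
theorem hasPBWStraightening_baseChange (hA : IsSkewPBWExtension R.toSubring x)
    (hbij : hA.IsBijective) (C : Type*) [CommRing C] [Algebra K C] :
    HasPBWStraightening (Algebra.TensorProduct.map (AlgHom.id K C) R.val).toRingHom
      (fun i => (1 : C) ⊗ₜ[K] x i)
      (fun i => (Algebra.TensorProduct.map (AlgHom.id K C) (hA.endoAlgHom i)).toRingHom) where
  span_eq_top := by
    set φ := (Algebra.TensorProduct.map (AlgHom.id K C) R.val).toRingHom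
    have hmem : ∀ (c : C) (r : R), c ⊗ₜ[K] (r : A) ∈ φ.range := fun c r => ⟨c ⊗ₜ r, by simp [φ]⟩
    rw [eq_top_iff]
    rintro b -
    induction b with
    | zero => exact zero_mem _
    | add a b ha hb => exact add_mem ha hb
    | tmul c a =>
      have ha : a ∈ Submodule.span R.toSubring (Set.range (stdMonomial x)) := by
        rw [hA.span_eq_top]
        trivial
      induction ha using Submodule.span_induction generalizing c with
      | mem a ha =>
        obtain ⟨α, rfl⟩ := ha
        have e : c ⊗ₜ[K] stdMonomial x α = c ⊗ₜ[K] ((1 : R) : A) *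
            stdMonomial (fun i => (1 : C) ⊗ₜ[K] x i) α := by
          have := map_stdMonomial
            (Algebra.TensorProduct.includeRight : A →ₐ[K] C ⊗[K] A).toRingHom x α
          simp only [AlgHom.toRingHom_eq_coe, RingHom.coe_coe,
            Algebra.TensorProduct.includeRight_apply] at this
          rw [← this]
          simp
        rw [e]
        exact mul_mem_of_mem_subring (hmem c 1) (Submodule.subset_span ⟨α, rfl⟩)
      | zero =>
        rw [TensorProduct.tmul_zero]
        exact zero_mem _
      | add a b _ _ ha hb =>
        rw [TensorProduct.tmul_add]
        exact add_mem (ha c) (hb c)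
      | smul r a _ ha =>
        -- The factor `c` is absorbed into the coefficient, so the induction hypothesis is applied
        -- to `1 ⊗ a`.
        have e : c ⊗ₜ[K] (r • a) = c ⊗ₜ[K] (r : A) * (1 : C) ⊗ₜ[K] a := by
          simp [Subring.smul_def]
        rw [e]
        exact mul_mem_of_mem_subring (hmem c ⟨r, r.2⟩) (ha 1)
  surjective i :=
    TensorProduct.map_surjective (g := (AlgHom.id K C).toLinearMap)
      (g' := (hA.endoAlgHom i).toLinearMap) Function.surjective_id (hbij.1 i).2
  mul_map i s := by
    induction s with
    | zero => simp
    | add s t hs ht =>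
      have e := add_mem hs ht
      rwa [← add_sub_add_comm, ← mul_add, ← add_mul, ← map_add, ← map_add, ← map_add] at e
    | tmul c r =>
      refine ⟨c ⊗ₜ ⟨_, hA.endo_spec i r⟩, ?_⟩
      simp [TensorProduct.tmul_sub, endoAlgHom_apply]
  exists_comm i j hij := by
    set φ := (Algebra.TensorProduct.map (AlgHom.id K C) R.val).toRingHom
    have hmem : ∀ (r : R), (1 : C) ⊗ₜ[K] (r : A) ∈ φ.range := fun r => ⟨1 ⊗ₜ r, by simp [φ]⟩
    obtain ⟨c, hcu, hc⟩ := hbij.2 i j hij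
    refine ⟨(1 : C) ⊗ₜ[K] (c : R), hcu.map
      (Algebra.TensorProduct.includeRight : R →ₐ[K] C ⊗[K] R), ?_⟩
    have key : ∀ a ∈ Submodule.span R.toSubring (insert 1 (Set.range x)), (1 : C) ⊗ₜ[K] a ∈
        Submodule.span φ.range (insert 1 (Set.range fun i => (1 : C) ⊗ₜ[K] x i)) := by
      intro a ha
      induction ha using Submodule.span_induction with
      | mem a ha =>
        refine Submodule.subset_span ?_
        rcases ha with rfl | ⟨k, rfl⟩
        · exact Or.inl rfl
        · exact Or.inr ⟨k, rfl⟩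
      | zero =>
        rw [TensorProduct.tmul_zero]
        exact zero_mem _
      | add a b _ _ ha hb =>
        rw [TensorProduct.tmul_add]
        exact add_mem ha hb
      | smul r a _ ha =>
        have e : (1 : C) ⊗ₜ[K] (r • a) = (1 : C) ⊗ₜ[K] (r : A) * (1 : C) ⊗ₜ[K] a := by
          simp [Subring.smul_def]
        rw [e]
        exact mul_mem_of_mem_subring (hmem ⟨r, r.2⟩) ha
    have e := key _ hc
    rw [TensorProduct.tmul_sub] at e
    simpa [φ] using e

end IsSkewPBWExtension

theorem mainTheorem2 {K : Type u} [CommRing K] {A : Type v} [Ring A] [Algebra K A]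
    (R : Subalgebra K A) {n : ℕ} (x : Fin n → A)
    (hA : IsSkewPBWExtension R.toSubring x) (hbij : hA.IsBijective)
    (hR : IsLeftStronglyNoetherian.{w} K R) :
    IsLeftStronglyNoetherian.{w} K A := by
  refine ⟨?_, fun C _ _ hC => ?_⟩
  · have : IsNoetherianRing R.toSubring := hR.1
    exact (hA.hasPBWStraightening hbij).isNoetherianRing
  · have := hR.2 C hC
    exact (hA.hasPBWStraightening_baseChange hbij C).isNoetherianRing
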